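/- Let $m\ge 1$ and $n\ge 2$ be integers. Throw $m$ balls independently and uniformly at random into $n$ urns, let $\xi_i$ be the number of balls in urn $i$, and let $X=(X_1,\dots,X_n)$ with $$X_i=\frac{\xi_i-m/n}{\sqrt{m(1-1/n)}},\qquad 1\le i\le n.$$ Let $\Sigma=(\operatorname{Cov}(X_i,X_j))_{1\le i,j\le n}$ be the covariance matrix of $X$, and let $Z\sim\mathrm{MVN}_n(0,\Sigma)$ be a centred $n$-dimensional Gaussian vector with covariance matrix $\Sigma$. For a three times partially differentiable function $h:\mathbb{R}^n\to\mathbb{R}$ (all iterated partial derivatives of order at most three exist everywhere) and $k\in\{2,3\}$ write $$|h|_k=\sup_{1\le i_1\le\dots\le i_k\le n}\ \sup_{x\in\mathbb{R}^n}|h_{i_1\dots i_k}(x)|\in[0,\infty],$$ where $h_{i_1\dots i_k}$ denotes the iterated partial derivative of $h$ in the coordinates $i_1,\dots,i_k$. Then, for every three times partially differentiable function $h:\mathbb{R}^n\to\mathbb{R}$, $$|\mathbb{E}h(X)-\mathbb{E}h(Z)|\le\bigl(|h|_2+19|h|_3\bigr)\sqrt{\frac{n^2+4mn+6}{mn(n-1)}}.$$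 Here $\mathbb{E}h(X)$ always exists, $\mathbb{E}h(Z)$ exists whenever $|h|_2$ and $|h|_3$ are finite, and the right-hand side is $+\infty$ (so that the bound is trivial) if one of them is infinite. -/

import Mathlib

open MeasureTheory ProbabilityTheory
open scoped ENNReal

namespace Occupancy

noncomputable section

/-- The partial derivative `f_i = ∂f/∂x_i` of a function on `ℝⁿ`. -/
def partialDeriv {n : ℕ} (i : Fin n) (f : EuclideanSpace ℝ (Fin n) → ℝ) :
    EuclideanSpace ℝ (Fin n) → ℝ :=
  fun x => lineDeriv ℝ f x (EuclideanSpace.single i 1)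

/-- `f` is `k` times partially differentiable: all iterated partial derivatives of order at most
`k`, with the differentiations taken in any order, exist at every point. No continuity of the
derivatives is required. -/
def PartiallyDifferentiable {n : ℕ} : ℕ → (EuclideanSpace ℝ (Fin n) → ℝ) → Prop
  | 0, _ => True
  | k + 1, f => ∀ i : Fin n,
      (∀ x, LineDifferentiableAt ℝ f x (EuclideanSpace.single i 1)) ∧
        PartiallyDifferentiable k (partialDeriv i f)

/-- The iterated partial derivative `f_{i₁ … i_k} = ((f_{i₁})_{i₂} …)_{i_k}`. -/
def iteratedPartial {n : ℕ} (f : EuclideanSpace ℝ (Fin n) → ℝ) :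
    List (Fin n) → EuclideanSpace ℝ (Fin n) → ℝ
  | [] => f
  | i :: l => iteratedPartial (partialDeriv i f) l

/-- `|f|_k`, the supremum over all `i₁ ≤ … ≤ i_k` of the supremum norm of `f_{i₁ … i_k}`,
possibly infinite. -/
def derivNorm {n : ℕ} (k : ℕ) (f : EuclideanSpace ℝ (Fin n) → ℝ) : ℝ≥0∞ :=
  ⨆ (i : Fin k → Fin n) (_ : Monotone i) (x : EuclideanSpace ℝ (Fin n)),
    ENNReal.ofReal |iteratedPartial f (List.ofFn i) x|

/-- The number of balls in urn `i` when ball `j` lies in urn `u j`. -/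
def urnCount {m n : ℕ} (u : Fin m → Fin n) (i : Fin n) : ℕ :=
  (Finset.univ.filter fun j => u j = i).card

/-- The vector of standardised urn counts `X_i = (ξ_i - m/n) / √(m (1 - 1/n))`. -/
def standardCounts {m n : ℕ} (u : Fin m → Fin n) : EuclideanSpace ℝ (Fin n) :=
  WithLp.toLp 2 fun i =>
    ((urnCount u i : ℝ) - (m : ℝ) / (n : ℝ)) / √((m : ℝ) * (1 - 1 / (n : ℝ)))

/-- The covariance matrix of a random vector. -/
def covMatrix {n : ℕ} {Ω : Type*} [MeasurableSpace Ω] (P : Measure Ω)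
    (X : Ω → EuclideanSpace ℝ (Fin n)) : Matrix (Fin n) (Fin n) ℝ :=
  Matrix.of fun i j => cov[fun ω => X ω i, fun ω => X ω j; P]

end

end Occupancy

/-!
The vector `X` of standardised urn counts is a normalised sum `m^{-1/2} ∑ Y_j` of independent
identically distributed centred vectors, one for each ball, and the `ℓ¹` norm of `Y_j` is at most
`2` whatever the number of urns. The proof compares this sum with the Gaussian law by Lindeberg's
replacement method, with all third order remainders measured in the `ℓ¹` norm: exchanging a
summand for another one with the same first two moments changes the expectation of `h` by at most
`|h|₃ / 6` times the sum of the two third absolute moments.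

Replacing the `Y_j` directly by Gaussian vectors would cost a power of the dimension, since the
`ℓ¹` norm of a Gaussian vector is of order `√n`. Instead every summand is split into two
independent summands of the same kind with half the covariance
(`HasCubicRemainder.abs_integral_normalizedPow_double_le`). Going from `N` to `2 N` summands costs
a multiple of `N^{-1/2}`, and the costs of the successive doublings form a geometric series. After
many doublings the crude comparison with the Gaussian law is affordable, because its dimensional
constant is multiplied by `(2 ^ k m)^{-1/2} → 0`
(`HasCubicRemainder.abs_integral_normalizedPow_sub_stable_le`). The resulting bound
`19 |h|₃ / √m` is at most the claimed one, since `1 / m ≤ (n² + 4 m n + 6) / (m n (n - 1))`.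

The Taylor expansion of `h` cannot be taken from the theory of continuously differentiable
functions, as the partial derivatives are only assumed to exist, and `|h|₃` only controls the
derivatives `h_{abc}` with `a ≤ b ≤ c`. It is obtained by changing the coordinates one at a time, the
last one first (`abs_sub_model_le`): along such a path exactly the derivatives with increasing
indices occur, and the one-dimensional remainders telescope to `|h|₃ / 6 * ‖y‖₁³`.
-/

namespace Occupancy

/-! ### Taylor expansion along coordinate paths -/

lemma abs_sub_poly_le_of_nonneg {φ φ' : ℝ → ℝ} (hφ : ∀ s, HasDerivAt φ (φ' s) s)
    {A B K r : ℝ} {k : ℕ} (hb : ∀ s, |φ' s - (A + B * s)| ≤ K * (r + |s|) ^ k) {t : ℝ}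
    (ht : 0 ≤ t) :
    |φ t - φ 0 - (A * t + B * t ^ 2 / 2)| ≤ K / (k + 1) * ((r + t) ^ (k + 1) - r ^ (k + 1)) := by
  have hf : ∀ s, HasDerivAt (fun s => φ s - φ 0 - (A * s + B * s ^ 2 / 2))
      (φ' s - (A + B * s)) s := by
    intro s
    have h1 : HasDerivAt (fun s : ℝ => A * s + B * s ^ 2 / 2) (A + B * s) s := by
      have h2 := ((hasDerivAt_id s).const_mul A).add
        ((((hasDerivAt_id s).pow 2).const_mul B).div_const 2)
      refine (h2.congr_deriv ?_)
      simp
      ring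
    exact ((hφ s).sub_const _).sub h1
  have hB : ∀ s, HasDerivAt (fun s => K / (k + 1) * ((r + s) ^ (k + 1) - r ^ (k + 1)))
      (K * (r + s) ^ k) s := by
    intro s
    have h2 := ((((hasDerivAt_id s).const_add r).pow (k + 1)).sub_const
      (r ^ (k + 1))).const_mul (K / (k + 1))
    refine h2.congr_deriv ?_
    have : (k : ℝ) + 1 ≠ 0 := by positivity
    simp
    field_simp
  have := image_norm_le_of_norm_deriv_right_le_deriv_boundary (a := 0) (b := t)
    (f := fun s => φ s - φ 0 - (A * s + B * s ^ 2 / 2)) (f' := fun s => φ' s - (A + B * s))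
    (fun s _ => (hf s).continuousAt.continuousWithinAt) (fun s _ => (hf s).hasDerivWithinAt)
    (B := fun s => K / (k + 1) * ((r + s) ^ (k + 1) - r ^ (k + 1)))
    (B' := fun s => K * (r + s) ^ k) (by simp) hB
    (fun s hs => by simpa [abs_of_nonneg hs.1] using hb s) (Set.right_mem_Icc.2 ht)
  simpa using this

/-- If `φ'` is affine up to an error `K (r + |s|) ^ k`, then `φ` is quadratic up to the integral
of that error. -/
lemma abs_sub_poly_le {φ φ' : ℝ → ℝ} (hφ : ∀ s, HasDerivAt φ (φ' s) s)
    {A B K r : ℝ} {k : ℕ} (hb : ∀ s, |φ' s - (A + B * s)| ≤ K * (r + |s|) ^ k) (t : ℝ) :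
    |φ t - φ 0 - (A * t + B * t ^ 2 / 2)| ≤
      K / (k + 1) * ((r + |t|) ^ (k + 1) - r ^ (k + 1)) := by
  rcases le_total 0 t with ht | ht
  · simpa [abs_of_nonneg ht] using abs_sub_poly_le_of_nonneg hφ hb ht
  · have h1 : ∀ s, HasDerivAt (fun s => φ (-s)) (-φ' (-s)) s := fun s => by
      have := (hφ (-s)).comp s (hasDerivAt_neg s)
      exact this.congr_deriv (by simp)
    have h2 := abs_sub_poly_le_of_nonneg h1 (A := -A) (B := B) (K := K) (r := r) (k := k)
      (fun s => by
        have h3 := hb (-s)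
        rw [abs_neg] at h3
        rwa [← abs_neg, show -(-φ' (-s) - (-A + B * s)) = φ' (-s) - (A + B * -s) by ring])
      (neg_nonneg.2 ht)
    rw [abs_of_nonpos ht]
    simpa using h2

/-- The `ℓ¹` norm on `ℝⁿ`. -/
def l1 {n : ℕ} (y : EuclideanSpace ℝ (Fin n)) : ℝ := ∑ i, |y i|

variable {n : ℕ}

lemma l1_nonneg (y : EuclideanSpace ℝ (Fin n)) : 0 ≤ l1 y :=
  Finset.sum_nonneg fun _ _ => abs_nonneg _

@[simp] lemma l1_zero : l1 (0 : EuclideanSpace ℝ (Fin n)) = 0 := by simp [l1]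

lemma l1_smul (c : ℝ) (y : EuclideanSpace ℝ (Fin n)) : l1 (c • y) = |c| * l1 y := by
  simp [l1, abs_mul, Finset.mul_sum]

lemma l1_add_le (x y : EuclideanSpace ℝ (Fin n)) : l1 (x + y) ≤ l1 x + l1 y := by
  rw [l1, l1, l1, ← Finset.sum_add_distrib]
  exact Finset.sum_le_sum fun i _ => abs_add_le _ _

lemma continuous_l1 : Continuous (l1 : EuclideanSpace ℝ (Fin n) → ℝ) := by
  unfold l1; fun_prop

lemma l1_add_single {y : EuclideanSpace ℝ (Fin n)} {b : Fin n} (hy : y b = 0) (t : ℝ) :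
    l1 (y + t • EuclideanSpace.single b 1) = l1 y + |t| := by
  unfold l1
  rw [← Finset.add_sum_erase _ _ (Finset.mem_univ b),
    ← Finset.add_sum_erase _ (fun i => |y i|) (Finset.mem_univ b)]
  have : ∑ i ∈ Finset.univ.erase b, |(y + t • EuclideanSpace.single b (1 : ℝ)) i| =
      ∑ i ∈ Finset.univ.erase b, |y i| :=
    Finset.sum_congr rfl fun i hi => by simp [Finset.ne_of_mem_erase hi]
  rw [this]
  simp [hy]
  ring

lemma hasDerivAt_partialDeriv {f : EuclideanSpace ℝ (Fin n) → ℝ} {b : Fin n}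
    (hf : ∀ x, LineDifferentiableAt ℝ f x (EuclideanSpace.single b 1))
    (x y : EuclideanSpace ℝ (Fin n)) (s : ℝ) :
    HasDerivAt (fun s : ℝ => f (x + (y + s • EuclideanSpace.single b 1)))
      (partialDeriv b f (x + (y + s • EuclideanSpace.single b 1))) s := by
  have h1 : HasDerivAt (fun t : ℝ => f ((x + (y + s • EuclideanSpace.single b 1)) +
      t • EuclideanSpace.single b 1))
      (partialDeriv b f (x + (y + s • EuclideanSpace.single b 1))) (s - s) := by
    rw [sub_self]
    exact (hf _).hasLineDerivAt
  refine (HasDerivAt.comp_sub_const s s h1).congr_of_eventuallyEq (.of_forall fun t => ?_)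
  have h2 : x + (y + t • EuclideanSpace.single b (1 : ℝ)) =
      x + (y + s • EuclideanSpace.single b 1) + (t - s) • EuclideanSpace.single b 1 := by
    module
  simp only [h2]

/-- The coordinate path argument. To go from `x` to `x + y`, the coordinates are changed one at a
time, the last one first. If along each segment the partial derivative of `f` agrees with that of
the model `p` up to `K (‖·‖₁) ^ k`, the errors add up telescopically. Only partial derivatives in
direction `b` at points whose displacement lives on coordinates `≥ b` are involved. -/
lemma abs_sub_model_le {f : EuclideanSpace ℝ (Fin n) → ℝ}
    (hf : ∀ b x, LineDifferentiableAt ℝ f x (EuclideanSpace.single b 1))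
    {p : EuclideanSpace ℝ (Fin n) → ℝ} (hp : p 0 = 0) {K : ℝ} {k : ℕ}
    {x : EuclideanSpace ℝ (Fin n)} {a : ℕ}
    (H : ∀ b : Fin n, a ≤ b → ∀ y : EuclideanSpace ℝ (Fin n), (∀ c ≤ b, y c = 0) →
      ∃ A B : ℝ,
        (∀ t : ℝ, p (y + t • EuclideanSpace.single b 1) = p y + (A * t + B * t ^ 2 / 2)) ∧
        ∀ s : ℝ, |partialDeriv b f (x + (y + s • EuclideanSpace.single b 1)) - (A + B * s)| ≤
          K * (l1 y + |s|) ^ k)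
    (y : EuclideanSpace ℝ (Fin n)) (hy : ∀ c : Fin n, (c : ℕ) < a → y c = 0) :
    |f (x + y) - f x - p y| ≤ K / (k + 1) * l1 y ^ (k + 1) := by
  suffices h : ∀ d : ℕ, ∀ y : EuclideanSpace ℝ (Fin n), (∀ c : Fin n, (c : ℕ) < a → y c = 0) →
      (∀ c : Fin n, (c : ℕ) + d < n → y c = 0) →
      |f (x + y) - f x - p y| ≤ K / (k + 1) * l1 y ^ (k + 1) from
    h n y hy fun c hc => by omega
  intro d
  induction d with
  | zero =>
    intro y _ hy
    have : y = 0 := by ext c; exact hy c (by simp)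
    subst this
    simp [hp]
  | succ d ih =>
    intro y hya hyd
    by_cases hdn : d < n
    swap
    · exact ih y hya fun c hc => by omega
    set b : Fin n := ⟨n - d - 1, by omega⟩ with hb
    by_cases hyb : y b = 0
    · refine ih y hya fun c hc => ?_
      by_cases hcb : c = b
      · rw [hcb, hyb]
      · refine hyd c ?_
        have : (c : ℕ) ≠ n - d - 1 := fun h => hcb (Fin.ext h)
        omega
    set z := y - y b • EuclideanSpace.single b (1 : ℝ) with hz
    have hyz : y = z + y b • EuclideanSpace.single b 1 := by simp [hz]
    have hzb : z b = 0 := by simp [hz]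
    have hzc : ∀ c, c ≠ b → z c = y c := fun c hc => by simp [hz, hc]
    have hzle : ∀ c ≤ b, z c = 0 := by
      intro c hc
      rcases eq_or_lt_of_le hc with rfl | hc
      · exact hzb
      · rw [hzc c hc.ne]
        refine hyd c ?_
        have : (c : ℕ) < n - d - 1 := hc
        omega
    have hab : a ≤ b := by
      by_contra hlt
      exact hyb (hya b (by omega))
    obtain ⟨A, B, hpAB, hAB⟩ := H b hab z hzle
    have h1 := ih z (fun c hc => by
        by_cases hcb : c = b
        · rw [hcb, hzb]
        · rw [hzc c hcb, hya c hc])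
      (fun c hc => hzle c (Fin.le_def.2 (by simp only [hb]; omega)))
    have h2 := abs_sub_poly_le (hasDerivAt_partialDeriv (hf b) x z) hAB (y b)
    rw [← hyz] at h2
    have h3 := hpAB (y b)
    rw [← hyz] at h3
    have h4 : l1 y = l1 z + |y b| := by
      conv_lhs => rw [hyz]
      exact l1_add_single hzb _
    simp only [zero_smul, add_zero] at h2
    rw [← h4] at h2
    calc |f (x + y) - f x - p y|
        = |(f (x + z) - f x - p z) + (f (x + y) - f (x + z) - (A * y b + B * y b ^ 2 / 2))| := by
          rw [h3]; congr 1; ring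
      _ ≤ _ := (abs_add_le _ _).trans (add_le_add h1 h2)
      _ = _ := by ring

/-- Order zero: bounded partial derivatives give a Lipschitz estimate in the `ℓ¹` norm. -/
lemma abs_sub_le_l1 {f : EuclideanSpace ℝ (Fin n) → ℝ} {a : ℕ} {M : ℝ}
    (hf : ∀ b x, LineDifferentiableAt ℝ f x (EuclideanSpace.single b 1))
    (hM : ∀ b : Fin n, a ≤ b → ∀ x, |partialDeriv b f x| ≤ M)
    (x y : EuclideanSpace ℝ (Fin n)) (hy : ∀ c : Fin n, (c : ℕ) < a → y c = 0) :
    |f (x + y) - f x| ≤ M * l1 y := by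
  have := abs_sub_model_le hf (p := fun _ => 0) rfl (K := M) (k := 0) (x := x) (a := a)
    (fun b hb y _ => ⟨0, 0, by simp, fun s => by simpa using hM b hb _⟩) y hy
  simpa using this

/-- Order one: only the second derivatives `f_{bc}` with `b ≤ c` have to be bounded, because the
coordinate path visits the coordinates in decreasing order. -/
lemma abs_sub_linear_le_l1 {f : EuclideanSpace ℝ (Fin n) → ℝ} {a : ℕ} {M : ℝ}
    (hf : ∀ b x, LineDifferentiableAt ℝ f x (EuclideanSpace.single b 1))
    (hf' : ∀ b c x, LineDifferentiableAt ℝ (partialDeriv b f) x (EuclideanSpace.single c 1))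
    (hM : ∀ b c : Fin n, a ≤ b → b ≤ c → ∀ x, |partialDeriv c (partialDeriv b f) x| ≤ M)
    (x y : EuclideanSpace ℝ (Fin n)) (hy : ∀ c : Fin n, (c : ℕ) < a → y c = 0) :
    |f (x + y) - f x - ∑ i, partialDeriv i f x * y i| ≤ M / 2 * l1 y ^ 2 := by
  have := abs_sub_model_le hf (p := fun y => ∑ i, partialDeriv i f x * y i) (by simp)
    (K := M) (k := 1) (x := x) (a := a)
    (fun b hb y hyb => ⟨partialDeriv b f x, 0, fun t => by
      simp [mul_add, Finset.sum_add_distrib], fun s => by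
      have h1 := abs_sub_le_l1 (hf' b) (fun c hc => hM b c hb hc) x
        (y + s • EuclideanSpace.single b 1) (fun c hc => by
          have hcb : c < b := hc
          simp [hyb c hcb.le, hcb.ne])
      rw [l1_add_single (hyb b le_rfl)] at h1
      simpa using h1⟩) y hy
  norm_num at this ⊢
  exact this

/-- `f` has a second order Taylor expansion at every point, with cubic remainder bounded by
`M / 6` times the third power of the `ℓ¹` norm. The quadratic form need not be given by a
symmetric matrix. -/
def HasCubicRemainder (M : ℝ) (f : EuclideanSpace ℝ (Fin n) → ℝ) : Prop :=
  ∀ x, ∃ (l : Fin n → ℝ) (q : Fin n → Fin n → ℝ), ∀ y : EuclideanSpace ℝ (Fin n),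
    |f (x + y) - (f x + ∑ i, l i * y i + ∑ i, ∑ j, q i j * (y i * y j))| ≤ M / 6 * l1 y ^ 3

/-- Order two. Bounds on the third derivatives `f_{abc}` with `a ≤ b ≤ c` suffice, so no symmetry
of mixed derivatives is needed, although none of the derivatives is assumed continuous. -/
lemma hasCubicRemainder_of_partialDeriv_le {f : EuclideanSpace ℝ (Fin n) → ℝ} {M : ℝ}
    (hf : PartiallyDifferentiable 3 f)
    (hM : ∀ a b c : Fin n, a ≤ b → b ≤ c →
      ∀ x, |partialDeriv c (partialDeriv b (partialDeriv a f)) x| ≤ M) :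
    HasCubicRemainder M f := by
  intro x
  -- The path uses the second derivatives `f_{bc}` with `b < c` for the mixed terms.
  set q : Fin n → Fin n → ℝ := fun b c => if b < c then partialDeriv c (partialDeriv b f) x else
    if b = c then partialDeriv b (partialDeriv b f) x / 2 else 0 with hq
  refine ⟨fun i => partialDeriv i f x, q, fun y => ?_⟩
  have := abs_sub_model_le (fun b => (hf b).1)
    (p := fun y => ∑ i, partialDeriv i f x * y i + ∑ i, ∑ j, q i j * (y i * y j)) (by simp)
    (K := M / 2) (k := 2) (x := x) (a := 0)
    (fun b _ y hyb => ⟨partialDeriv b f x + ∑ c, partialDeriv c (partialDeriv b f) x * y c,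
      partialDeriv b (partialDeriv b f) x, fun t => ?_, fun s => ?_⟩) y (by simp)
  · norm_num at this ⊢
    convert this using 2 <;> ring
  · have h1 : ∑ i, q i b * y i = 0 := Finset.sum_eq_zero fun i _ => by
      rcases le_or_gt i b with hi | hi
      · simp [hyb i hi]
      · simp [hq, hi.not_gt, hi.ne']
    have h2 : ∑ i, q b i * y i = ∑ i, partialDeriv i (partialDeriv b f) x * y i :=
      Finset.sum_congr rfl fun i _ => by
        rcases le_or_gt i b with hi | hi
        · simp [hyb i hi]
        · simp [hq, hi]
    have h3 : q b b = partialDeriv b (partialDeriv b f) x / 2 := by simp [hq]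
    have h4 : ∀ i j, q i j * ((y + t • EuclideanSpace.single b (1 : ℝ)) i *
        (y + t • EuclideanSpace.single b (1 : ℝ)) j) = q i j * (y i * y j)
        + (if i = b then t * (q i j * y j) else 0) + (if j = b then t * (q i j * y i) else 0)
        + (if i = b then (if j = b then q i j * t ^ 2 else 0) else 0) := by
      intro i j
      by_cases hi : i = b <;> by_cases hj : j = b <;>
        simp [hi, hj] <;> ring
    have h5 : ∀ i, partialDeriv i f x * (y + t • EuclideanSpace.single b (1 : ℝ)) i =
        partialDeriv i f x * y i + (if i = b then t * partialDeriv i f x else 0) := by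
      intro i
      by_cases hi : i = b
      · simp [hi]
        ring
      · simp [hi]
    simp only [h4, h5, Finset.sum_add_distrib]
    have h6 : ∑ i, ∑ j, (if i = b then t * (q i j * y j) else 0) = t * ∑ j, q b j * y j := by
      rw [Finset.sum_eq_single b (fun i _ hi => by simp [hi]) (by simp)]
      simp [Finset.mul_sum]
    have h7 : ∑ i, ∑ j, (if i = b then (if j = b then q i j * t ^ 2 else 0) else 0) =
        q b b * t ^ 2 := by
      rw [Finset.sum_eq_single b (fun i _ hi => by simp [hi]) (by simp)]
      simp
    rw [h6, h7, h2, h3]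
    simp only [Finset.sum_ite_eq', Finset.mem_univ, if_true]
    rw [← Finset.mul_sum, h1]
    ring
  · have h1 := abs_sub_linear_le_l1 (a := b) (fun c => ((hf b).2 c).1)
      (fun c d => (((hf b).2 c).2 d).1) (fun c d hc hd => hM b c d hc hd) x
        (y + s • EuclideanSpace.single b 1) (fun c hc => by
          have hcb : c < b := hc
          simp [hyb c hcb.le, hcb.ne])
    rw [l1_add_single (hyb b le_rfl)] at h1
    refine le_trans (le_of_eq ?_) h1
    congr 1
    simp [mul_add, Finset.sum_add_distrib]
    ring

lemma hasCubicRemainder_of_derivNorm_ne_top {f : EuclideanSpace ℝ (Fin n) → ℝ}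
    (hf : PartiallyDifferentiable 3 f) (h3 : derivNorm 3 f ≠ ∞) :
    HasCubicRemainder (derivNorm 3 f).toReal f := by
  refine hasCubicRemainder_of_partialDeriv_le hf fun a b c hab hbc x => ?_
  have hmono : Monotone ![a, b, c] := by
    rw [Fin.monotone_iff_le_succ]
    intro i
    fin_cases i
    · exact hab
    · exact hbc
  have h1 : ENNReal.ofReal |iteratedPartial f (List.ofFn ![a, b, c]) x| ≤ derivNorm 3 f :=
    le_iSup₂_of_le (f := fun (i : Fin 3 → Fin n) (_ : Monotone i) =>
      ⨆ x, ENNReal.ofReal |iteratedPartial f (List.ofFn i) x|) ![a, b, c] hmono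
      (le_iSup (fun x => ENNReal.ofReal |iteratedPartial f (List.ofFn ![a, b, c]) x|) x)
  rw [ENNReal.ofReal_le_iff_le_toReal h3] at h1
  simpa [List.ofFn_succ, iteratedPartial] using h1

/-! ### Moments of measures on `ℝⁿ` and their convolutions -/

/-- The third absolute moment of `μ` with respect to the `ℓ¹` norm. -/
noncomputable def thirdMoment (μ : Measure (EuclideanSpace ℝ (Fin n))) : ℝ := ∫ y, l1 y ^ 3 ∂μ

/-- `μ` has finite third moments, is centred and has covariance matrix `S`. -/
structure HasMoments (μ : Measure (EuclideanSpace ℝ (Fin n))) (S : Fin n → Fin n → ℝ) : Prop where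
  memLp : MemLp id 3 μ
  mean : ∀ i, ∫ y, y i ∂μ = 0
  cov : ∀ i j, ∫ y, y i * y j ∂μ = S i j

lemma memLp_coord {μ : Measure (EuclideanSpace ℝ (Fin n))} (h : MemLp id 3 μ) (i : Fin n) :
    MemLp (fun y : EuclideanSpace ℝ (Fin n) => y i) 3 μ :=
  MemLp.of_le_mul (c := 1) h (Measurable.aestronglyMeasurable (by fun_prop))
    (.of_forall fun y => by simpa using PiLp.norm_apply_le y i)

lemma integrable_l1_pow {μ : Measure (EuclideanSpace ℝ (Fin n))} (h : MemLp id 3 μ) :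
    Integrable (fun y : EuclideanSpace ℝ (Fin n) => l1 y ^ 3) μ := by
  have h1 : MemLp (fun y : EuclideanSpace ℝ (Fin n) => l1 y) 3 μ :=
    memLp_finsetSum _ fun i _ => (memLp_coord h i).abs
  have h2 := MemLp.integrable_norm_pow (p := 3) (by exact_mod_cast h1) (by norm_num)
  simpa [abs_of_nonneg (l1_nonneg _)] using h2

lemma memLp_scale {μ : Measure (EuclideanSpace ℝ (Fin n))} (hμ : MemLp id 3 μ) (c : ℝ) :
    MemLp id 3 (μ.map (c • ·)) := by
  rw [memLp_map_measure_iff (by fun_prop) (by fun_prop)]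
  exact hμ.const_smul c

lemma aestronglyMeasurable_l1_pow {μ : Measure (EuclideanSpace ℝ (Fin n))} :
    AEStronglyMeasurable (fun y : EuclideanSpace ℝ (Fin n) => l1 y ^ 3) μ :=
  (continuous_l1.pow 3).aestronglyMeasurable

lemma thirdMoment_scale {μ : Measure (EuclideanSpace ℝ (Fin n))} {c : ℝ} (hc : 0 ≤ c) :
    thirdMoment (μ.map (c • ·)) = c ^ 3 * thirdMoment μ := by
  unfold thirdMoment
  rw [integral_map (by fun_prop) aestronglyMeasurable_l1_pow]
  simp [l1_smul, abs_of_nonneg hc, mul_pow, integral_const_mul]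

lemma thirdMoment_nonneg {μ : Measure (EuclideanSpace ℝ (Fin n))} : 0 ≤ thirdMoment μ :=
  integral_nonneg fun y => pow_nonneg (l1_nonneg y) 3

lemma HasMoments.scale {μ : Measure (EuclideanSpace ℝ (Fin n))} {S : Fin n → Fin n → ℝ}
    (hμ : HasMoments μ S) (c : ℝ) :
    HasMoments (μ.map (c • ·)) (c ^ 2 • S) where
  memLp := memLp_scale hμ.memLp c
  mean i := by
    rw [integral_map (by fun_prop) (Measurable.aestronglyMeasurable (by fun_prop))]
    simp [integral_const_mul, hμ.mean]
  cov i j := by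
    rw [integral_map (by fun_prop) (Measurable.aestronglyMeasurable (by fun_prop))]
    have : ∀ y : EuclideanSpace ℝ (Fin n), (c • y) i * (c • y) j = c ^ 2 * (y i * y j) :=
      fun y => by simp; ring
    simp only [this, integral_const_mul, hμ.cov]
    simp

section

variable {μ ν : Measure (EuclideanSpace ℝ (Fin n))} [IsProbabilityMeasure μ]
  [IsProbabilityMeasure ν]

lemma integrable_coord (h : MemLp id 3 μ) (i : Fin n) :
    Integrable (fun y : EuclideanSpace ℝ (Fin n) => y i) μ :=
  (memLp_coord h i).integrable (by norm_num)

lemma integrable_coord_mul (h : MemLp id 3 μ) (i j : Fin n) :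
    Integrable (fun y : EuclideanSpace ℝ (Fin n) => y i * y j) μ :=
  MemLp.integrable_mul ((memLp_coord h i).mono_exponent (by norm_num))
    ((memLp_coord h j).mono_exponent (by norm_num)) (p := 2) (q := 2)

lemma integrable_quadratic (h : MemLp id 3 μ) (c : ℝ) (l : Fin n → ℝ) (q : Fin n → Fin n → ℝ) :
    Integrable (fun y : EuclideanSpace ℝ (Fin n) =>
      c + ∑ i, l i * y i + ∑ i, ∑ j, q i j * (y i * y j)) μ :=
  ((integrable_const c).add
    (integrable_finsetSum _ fun i _ => (integrable_coord h i).const_mul _)).add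
    (integrable_finsetSum _ fun i _ => integrable_finsetSum _ fun j _ =>
      (integrable_coord_mul h i j).const_mul _)

/-- The integral of a quadratic polynomial depends only on the covariance matrix. -/
lemma HasMoments.integral_quadratic {S : Fin n → Fin n → ℝ} (h : HasMoments μ S) (c : ℝ)
    (l : Fin n → ℝ) (q : Fin n → Fin n → ℝ) :
    ∫ y, (c + ∑ i, l i * y i + ∑ i, ∑ j, q i j * (y i * y j)) ∂μ =
      c + ∑ i, ∑ j, q i j * S i j := by
  have h1 : ∀ i, Integrable (fun y : EuclideanSpace ℝ (Fin n) => l i * y i) μ :=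
    fun i => (integrable_coord h.memLp i).const_mul _
  have h2 : ∀ i j, Integrable (fun y : EuclideanSpace ℝ (Fin n) => q i j * (y i * y j)) μ :=
    fun i j => (integrable_coord_mul h.memLp i j).const_mul _
  have h3 : Integrable (fun y : EuclideanSpace ℝ (Fin n) => c + ∑ i, l i * y i) μ :=
    (integrable_const c).add (integrable_finsetSum _ fun i _ => h1 i)
  rw [integral_add h3
    (integrable_finsetSum _ fun i _ => integrable_finsetSum _ fun j _ => h2 i j),
    integral_add (integrable_const c) (integrable_finsetSum _ fun i _ => h1 i),
    integral_finsetSum _ fun i _ => h1 i,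
    integral_finsetSum _ fun i _ => integrable_finsetSum _ fun j _ => h2 i j]
  simp only [integral_finsetSum _ fun j _ => h2 _ j, integral_const_mul, h.mean, h.cov]
  simp

lemma memLp_conv (hμ : MemLp id 3 μ) (hν : MemLp id 3 ν) : MemLp id 3 (μ ∗ ν) := by
  rw [Measure.conv, memLp_map_measure_iff (by fun_prop) (by fun_prop)]
  exact (hμ.comp_fst ν).add (hν.comp_snd μ)

lemma HasMoments.conv {S S' : Fin n → Fin n → ℝ} (hμ : HasMoments μ S) (hν : HasMoments ν S') :
    HasMoments (μ ∗ ν) (S + S') where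
  memLp := memLp_conv hμ.memLp hν.memLp
  mean i := by
    rw [integral_conv (integrable_coord (memLp_conv hμ.memLp hν.memLp) i)]
    simp [integral_add (integrable_const _) (integrable_coord hν.memLp i), hν.mean, hμ.mean]
  cov i j := by
    rw [integral_conv (integrable_coord_mul (memLp_conv hμ.memLp hν.memLp) i j)]
    have h1 : ∀ x : EuclideanSpace ℝ (Fin n), ∫ y, (x + y) i * (x + y) j ∂ν =
        x i * x j + S' i j := by
      intro x
      have i1 := (integrable_coord hν.memLp j).const_mul (x i)
      have i2 := (integrable_coord hν.memLp i).const_mul (x j)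
      have i3 := integrable_coord_mul hν.memLp i j
      have i4 : Integrable (fun y : EuclideanSpace ℝ (Fin n) => x i * x j + x i * y j) ν :=
        (integrable_const _).add i1
      have i5 : Integrable (fun y : EuclideanSpace ℝ (Fin n) =>
          x i * x j + x i * y j + x j * y i) ν := i4.add i2
      calc ∫ y, (x + y) i * (x + y) j ∂ν
          = ∫ y, (x i * x j + x i * y j + x j * y i + y i * y j) ∂ν := by
            congr 1; ext y; simp; ring
        _ = _ := by
            rw [integral_add i5 i3, integral_add i4 i2, integral_add (integrable_const _) i1,
              integral_const_mul (x i) (fun y : EuclideanSpace ℝ (Fin n) => y j),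
              integral_const_mul (x j) (fun y : EuclideanSpace ℝ (Fin n) => y i), hν.mean, hν.mean,
              hν.cov]
            simp
    simp only [h1]
    rw [integral_add (integrable_coord_mul hμ.memLp i j) (integrable_const _), hμ.cov]
    simp

lemma thirdMoment_conv_le (hμ : MemLp id 3 μ) (hν : MemLp id 3 ν) :
    thirdMoment (μ ∗ ν) ≤ 4 * (thirdMoment μ + thirdMoment ν) := by
  unfold thirdMoment
  rw [Measure.conv, integral_map (by fun_prop) aestronglyMeasurable_l1_pow]
  have h1 : Integrable (fun z : EuclideanSpace ℝ (Fin n) × EuclideanSpace ℝ (Fin n) =>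
      l1 z.1 ^ 3) (μ.prod ν) := (integrable_l1_pow hμ).comp_fst ν
  have h2 : Integrable (fun z : EuclideanSpace ℝ (Fin n) × EuclideanSpace ℝ (Fin n) =>
      l1 z.2 ^ 3) (μ.prod ν) := (integrable_l1_pow hν).comp_snd μ
  calc ∫ z, l1 (z.1 + z.2) ^ 3 ∂μ.prod ν
      ≤ ∫ z, 4 * (l1 z.1 ^ 3 + l1 z.2 ^ 3) ∂μ.prod ν := by
        refine integral_mono_of_nonneg (.of_forall fun z => pow_nonneg (l1_nonneg _) 3)
          ((h1.add h2).const_mul 4) (.of_forall fun z => ?_)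
        refine (pow_le_pow_left₀ (l1_nonneg _) (l1_add_le _ _) 3).trans ?_
        refine (add_pow_le (l1_nonneg _) (l1_nonneg _) 3).trans (le_of_eq ?_)
        norm_num
    _ = _ := by
        rw [integral_const_mul, integral_add h1 h2,
          integral_fun_fst (fun y : EuclideanSpace ℝ (Fin n) => l1 y ^ 3),
          integral_fun_snd (fun y : EuclideanSpace ℝ (Fin n) => l1 y ^ 3)]
        simp

/-! ### Convolution powers -/

/-- The `N`-fold convolution of `μ` with itself. -/
noncomputable def convPow (μ : Measure (EuclideanSpace ℝ (Fin n))) :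
    ℕ → Measure (EuclideanSpace ℝ (Fin n))
  | 0 => Measure.dirac 0
  | N + 1 => convPow μ N ∗ μ

instance isProbabilityMeasure_convPow (N : ℕ) : IsProbabilityMeasure (convPow μ N) := by
  induction N with
  | zero => unfold convPow; infer_instance
  | succ N ih => unfold convPow; infer_instance

instance isProbabilityMeasure_scale (c : ℝ) : IsProbabilityMeasure (μ.map (c • ·)) :=
  Measure.isProbabilityMeasure_map (by fun_prop)

lemma charFun_convPow (N : ℕ) (t : EuclideanSpace ℝ (Fin n)) :
    charFun (convPow μ N) t = charFun μ t ^ N := by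
  induction N with
  | zero => simp [convPow, charFun_dirac]
  | succ N ih => rw [convPow, charFun_conv, ih, pow_succ]

lemma hasMoments_dirac_zero : HasMoments (Measure.dirac (0 : EuclideanSpace ℝ (Fin n))) 0 where
  memLp := by
    refine MemLp.of_bound (by fun_prop) 0 ?_
    rw [ae_dirac_iff (measurableSet_le (by fun_prop) (by fun_prop))]
    simp
  mean i := by simp
  cov i j := by simp

lemma HasMoments.convPow {S : Fin n → Fin n → ℝ} (hμ : HasMoments μ S) (N : ℕ) :
    HasMoments (convPow μ N) ((N : ℝ) • S) := by
  induction N with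
  | zero => simpa [Occupancy.convPow] using hasMoments_dirac_zero
  | succ N ih =>
    have := ih.conv hμ
    rw [show ((N + 1 : ℕ) : ℝ) • S = (N : ℝ) • S + S by push_cast; module]
    exact this

lemma convPow_conv_self (N : ℕ) : convPow (μ ∗ μ) N = convPow μ (2 * N) := by
  refine Measure.ext_of_charFun ?_
  ext t
  rw [charFun_convPow, charFun_convPow, charFun_conv, pow_mul, sq]

end

/-! ### Replacement of the convolution factors -/

section

variable {M : ℝ} {h : EuclideanSpace ℝ (Fin n) → ℝ}

lemma HasCubicRemainder.continuous (hh : HasCubicRemainder M h) : Continuous h := by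
  rw [continuous_iff_continuousAt]
  intro x
  obtain ⟨l, q, hlq⟩ := hh x
  have hl := continuous_l1 (n := n)
  have h1 : Filter.Tendsto (fun z : EuclideanSpace ℝ (Fin n) =>
      h z - (h x + ∑ i, l i * (z - x) i + ∑ i, ∑ j, q i j * ((z - x) i * (z - x) j)))
      (nhds x) (nhds 0) := by
    have h2 : Continuous fun z : EuclideanSpace ℝ (Fin n) => M / 6 * l1 (z - x) ^ 3 := by
      fun_prop
    refine squeeze_zero_norm (fun z => ?_) (h2.tendsto' x 0 (by simp))
    simpa using hlq (z - x)
  have h3 : Continuous fun z : EuclideanSpace ℝ (Fin n) =>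
      h x + ∑ i, l i * (z - x) i + ∑ i, ∑ j, q i j * ((z - x) i * (z - x) j) := by
    fun_prop
  have h4 := h1.add (h3.tendsto x)
  simp only [sub_add_cancel] at h4
  simpa [ContinuousAt] using h4

variable {μ ν ρ : Measure (EuclideanSpace ℝ (Fin n))} [IsProbabilityMeasure μ]
  [IsProbabilityMeasure ν] [IsProbabilityMeasure ρ]

lemma HasCubicRemainder.integrable_comp_add (hh : HasCubicRemainder M h) (hμ : MemLp id 3 μ)
    (x : EuclideanSpace ℝ (Fin n)) : Integrable (fun y => h (x + y)) μ := by
  obtain ⟨l, q, hlq⟩ := hh x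
  have hc := hh.continuous
  have h0 := integrable_quadratic hμ (h x) l q
  have h1 : Integrable (fun y => h (x + y) -
      (h x + ∑ i, l i * y i + ∑ i, ∑ j, q i j * (y i * y j))) μ :=
    ((integrable_l1_pow hμ).const_mul (M / 6)).mono'
      (Continuous.aestronglyMeasurable (by fun_prop)) (.of_forall hlq)
  exact (h1.add h0).congr (.of_forall fun y => by simp)

lemma HasCubicRemainder.integrable (hh : HasCubicRemainder M h) (hμ : MemLp id 3 μ) :
    Integrable h μ := by
  simpa using hh.integrable_comp_add hμ 0

/-- The Taylor polynomials at `x` have the same integral with respect to `μ` and `ν`, so only the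
remainders contribute. -/
lemma HasCubicRemainder.abs_integral_comp_add_sub_le (hh : HasCubicRemainder M h)
    {S : Fin n → Fin n → ℝ} (hμ : HasMoments μ S) (hν : HasMoments ν S)
    (x : EuclideanSpace ℝ (Fin n)) :
    |∫ y, h (x + y) ∂μ - ∫ y, h (x + y) ∂ν| ≤ M / 6 * (thirdMoment μ + thirdMoment ν) := by
  obtain ⟨l, q, hlq⟩ := hh x
  have key : ∀ (κ : Measure (EuclideanSpace ℝ (Fin n))) [IsProbabilityMeasure κ],
      HasMoments κ S →
      |∫ y, h (x + y) ∂κ - (h x + ∑ i, ∑ j, q i j * S i j)| ≤ M / 6 * thirdMoment κ := by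
    intro κ _ hκ
    rw [← hκ.integral_quadratic (h x) l q, ← integral_sub (hh.integrable_comp_add hκ.memLp x)
      (integrable_quadratic hκ.memLp _ _ _), thirdMoment, ← integral_const_mul,
      ← Real.norm_eq_abs]
    exact norm_integral_le_of_norm_le ((integrable_l1_pow hκ.memLp).const_mul _)
      (.of_forall fun y => by simpa using hlq y)
  have h1 := key μ hμ
  have h2 := key ν hν
  rw [abs_le] at h1 h2 ⊢
  constructor <;> linarith [h1.1, h1.2, h2.1, h2.2]

/-- Replacing one convolution factor by another one with the same first and second moments. -/
lemma HasCubicRemainder.abs_integral_conv_sub_le (hh : HasCubicRemainder M h)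
    {S : Fin n → Fin n → ℝ} (hρ : MemLp id 3 ρ) (hμ : HasMoments μ S) (hν : HasMoments ν S) :
    |∫ z, h z ∂(ρ ∗ μ) - ∫ z, h z ∂(ρ ∗ ν)| ≤ M / 6 * (thirdMoment μ + thirdMoment ν) := by
  have iμ := hh.integrable (memLp_conv hρ hμ.memLp)
  have iν := hh.integrable (memLp_conv hρ hν.memLp)
  rw [integral_conv iμ, integral_conv iν, ← integral_sub, ← Real.norm_eq_abs]
  · refine (norm_integral_le_of_norm_le_const (C := M / 6 * (thirdMoment μ + thirdMoment ν))
      (.of_forall fun x => by simpa using hh.abs_integral_comp_add_sub_le hμ hν x)).trans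
        (le_of_eq ?_)
    simp
  · exact ((integrable_map_measure iμ.1 (by fun_prop)).1 iμ).integral_prod_left
  · exact ((integrable_map_measure iν.1 (by fun_prop)).1 iν).integral_prod_left

/-- Lindeberg's replacement argument for convolution powers. -/
lemma HasCubicRemainder.abs_integral_convPow_sub_le (hh : HasCubicRemainder M h)
    {S : Fin n → Fin n → ℝ} (hμ : HasMoments μ S) (hν : HasMoments ν S) (N : ℕ) :
    |∫ z, h z ∂(convPow μ N) - ∫ z, h z ∂(convPow ν N)| ≤
      N * (M / 6 * (thirdMoment μ + thirdMoment ν)) := by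
  -- A further convolution factor `ρ` makes the induction go through.
  suffices H : ∀ (ρ : Measure (EuclideanSpace ℝ (Fin n))) [IsProbabilityMeasure ρ],
      MemLp id 3 ρ → |∫ z, h z ∂(ρ ∗ convPow μ N) - ∫ z, h z ∂(ρ ∗ convPow ν N)| ≤
        N * (M / 6 * (thirdMoment μ + thirdMoment ν)) by
    simpa [Measure.dirac_zero_conv] using H (Measure.dirac 0) hasMoments_dirac_zero.memLp
  induction N with
  | zero => intro ρ _ _; simp [convPow]
  | succ N ih =>
    intro ρ _ hρ
    have h1 := hh.abs_integral_conv_sub_le (memLp_conv hρ (hμ.convPow N).memLp) hμ hν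
    have h2 := ih (ρ ∗ ν) (memLp_conv hρ hν.memLp)
    have h3 : ∀ κ : Measure (EuclideanSpace ℝ (Fin n)), ∀ [IsProbabilityMeasure κ],
        (ρ ∗ ν) ∗ κ = (ρ ∗ κ) ∗ ν := fun κ _ => by
      rw [Measure.conv_assoc, Measure.conv_comm ν κ, ← Measure.conv_assoc]
    rw [h3, h3] at h2
    rw [convPow, convPow, ← Measure.conv_assoc, ← Measure.conv_assoc]
    refine (abs_sub_le _ _ _).trans ((add_le_add h1 h2).trans (le_of_eq ?_))
    push_cast
    ring

end

/-! ### A rate of convergence for smooth test functions by doubling -/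

section

variable {M : ℝ} {h : EuclideanSpace ℝ (Fin n) → ℝ} {μ ν : Measure (EuclideanSpace ℝ (Fin n))}
  [IsProbabilityMeasure μ] [IsProbabilityMeasure ν]

/-- The law of `(Y₁ + ⋯ + Y_N) / √N` for independent `Y_j` with law `μ`. -/
noncomputable def normalizedPow (μ : Measure (EuclideanSpace ℝ (Fin n))) (N : ℕ) :
    Measure (EuclideanSpace ℝ (Fin n)) :=
  convPow (μ.map ((√(N : ℝ))⁻¹ • ·)) N

lemma HasMoments.normalizedPow {S : Fin n → Fin n → ℝ} (hμ : HasMoments μ S) {N : ℕ}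
    (hN : 0 < N) : HasMoments (normalizedPow μ N) S := by
  have h1 := (hμ.scale (√(N : ℝ))⁻¹).convPow N
  rw [smul_smul, inv_pow, Real.sq_sqrt (by positivity), mul_inv_cancel₀ (by positivity),
    one_smul] at h1
  exact h1

/-- Comparison of two normalised sums. The bound involves the third moments of both laws, so for
Gaussian `ν` it grows with the dimension; it serves to identify the limit. -/
lemma HasCubicRemainder.abs_integral_normalizedPow_sub_le (hh : HasCubicRemainder M h)
    {S : Fin n → Fin n → ℝ} (hμ : HasMoments μ S) (hν : HasMoments ν S) {N : ℕ} (hN : 0 < N) :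
    |∫ z, h z ∂(normalizedPow μ N) - ∫ z, h z ∂(normalizedPow ν N)| ≤
      M / 6 * (thirdMoment μ + thirdMoment ν) * (√(N : ℝ))⁻¹ := by
  refine (hh.abs_integral_convPow_sub_le (hμ.scale _) (hν.scale _) N).trans (le_of_eq ?_)
  rw [thirdMoment_scale (by positivity), thirdMoment_scale (by positivity)]
  have h1 : (N : ℝ) * (√(N : ℝ))⁻¹ ^ 2 = 1 := by
    rw [inv_pow, Real.sq_sqrt (by positivity), mul_inv_cancel₀ (by positivity)]
  linear_combination (M / 6 * (thirdMoment μ + thirdMoment ν) * (√(N : ℝ))⁻¹) * h1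

/-- Splitting every summand into two independent ones with half the covariance. The constant
`19 / 8` turns the bound into a difference, so that it telescopes over repeated doublings. -/
lemma HasCubicRemainder.abs_integral_normalizedPow_double_le (hh : HasCubicRemainder M h)
    (hM : 0 ≤ M) {S : Fin n → Fin n → ℝ} (hμ : HasMoments μ S) {N : ℕ} (hN : 0 < N) :
    |∫ z, h z ∂(normalizedPow μ N) - ∫ z, h z ∂(normalizedPow μ (2 * N))| ≤
      19 / 8 * M * thirdMoment μ * ((√(N : ℝ))⁻¹ - (√((2 * N : ℕ) : ℝ))⁻¹) := by
  set r := (√(N : ℝ))⁻¹ with hr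
  set w := (√(2 : ℝ))⁻¹ with hw
  have hw2 : w ^ 2 = 1 / 2 := by rw [hw, inv_pow, Real.sq_sqrt (by norm_num)]; norm_num
  have hw0 : 0 ≤ w := by positivity
  have hr0 : 0 ≤ r := by positivity
  have hrN : (N : ℝ) * r ^ 2 = 1 := by
    rw [hr, inv_pow, Real.sq_sqrt (by positivity), mul_inv_cancel₀ (by positivity)]
  have hr2 : (√((2 * N : ℕ) : ℝ))⁻¹ = w * r := by
    push_cast
    rw [Real.sqrt_mul (by norm_num), mul_inv]
  rw [normalizedPow, normalizedPow, hr2, ← convPow_conv_self, ← hr]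
  have hconv : HasMoments (μ.map ((w * r) • ·) ∗ μ.map ((w * r) • ·)) (r ^ 2 • S) := by
    have h1 := (hμ.scale (w * r)).conv (hμ.scale (w * r))
    rw [← add_smul] at h1
    rwa [show (w * r) ^ 2 + (w * r) ^ 2 = r ^ 2 by rw [mul_pow, hw2]; ring] at h1
  refine (hh.abs_integral_convPow_sub_le (hμ.scale r) hconv N).trans ?_
  have hT : 0 ≤ thirdMoment μ := thirdMoment_nonneg
  have h2 := thirdMoment_conv_le (memLp_scale hμ.memLp (w * r)) (memLp_scale hμ.memLp (w * r))
  rw [thirdMoment_scale (by positivity)] at h2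
  rw [thirdMoment_scale hr0]
  -- `(1 + 4 w) / 6 ≤ 19 / 8 * (1 - w)` holds for `w ≤ 106 / 146`.
  have hwle : w ≤ 0.72 := by
    by_contra hlt
    push Not at hlt
    nlinarith
  calc N * (M / 6 * (r ^ 3 * thirdMoment μ +
        thirdMoment (μ.map ((w * r) • ·) ∗ μ.map ((w * r) • ·))))
      ≤ N * (M / 6 * (r ^ 3 * thirdMoment μ +
        4 * ((w * r) ^ 3 * thirdMoment μ + (w * r) ^ 3 * thirdMoment μ))) := by gcongr
    _ = (M * thirdMoment μ * r) * ((1 + 4 * w) / 6) := by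
        linear_combination (M * thirdMoment μ * r * (1 + 8 * w ^ 3) / 6) * hrN +
          (M * thirdMoment μ * r * (8 * w) / 6) * hw2
    _ ≤ (M * thirdMoment μ * r) * (19 / 8 * (1 - w)) := by
        gcongr
        linarith
    _ = _ := by ring

/-- A Berry–Esseen type bound for smooth test functions. The hypothesis `hstable` expresses that
`γ` is stable with exponent two, so that it is the limit law. -/
lemma HasCubicRemainder.abs_integral_normalizedPow_sub_stable_le (hh : HasCubicRemainder M h)
    (hM : 0 ≤ M) {S : Fin n → Fin n → ℝ} (hμ : HasMoments μ S)
    {γ : Measure (EuclideanSpace ℝ (Fin n))} [IsProbabilityMeasure γ] (hγ : HasMoments γ S)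
    (hstable : ∀ N, 0 < N → normalizedPow γ N = γ) {m : ℕ} (hm : 0 < m) :
    |∫ z, h z ∂(normalizedPow μ m) - ∫ z, h z ∂γ| ≤
      19 / 8 * M * thirdMoment μ * (√(m : ℝ))⁻¹ := by
  set C := 19 / 8 * M * thirdMoment μ
  have h1 : ∀ k : ℕ,
      |∫ z, h z ∂(normalizedPow μ m) - ∫ z, h z ∂(normalizedPow μ (2 ^ k * m))| ≤
      C * ((√(m : ℝ))⁻¹ - (√((2 ^ k * m : ℕ) : ℝ))⁻¹) := by
    intro k
    induction k with
    | zero => simp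
    | succ k ih =>
      have h2 := hh.abs_integral_normalizedPow_double_le hM hμ (N := 2 ^ k * m) (by positivity)
      rw [pow_succ', mul_assoc]
      refine (abs_sub_le _ _ _).trans ((add_le_add ih h2).trans (le_of_eq ?_))
      ring
  set D := M / 6 * (thirdMoment μ + thirdMoment γ)
  have h3 : ∀ k : ℕ, |∫ z, h z ∂(normalizedPow μ m) - ∫ z, h z ∂γ| ≤
      C * ((√(m : ℝ))⁻¹ - (√((2 ^ k * m : ℕ) : ℝ))⁻¹) + D * (√((2 ^ k * m : ℕ) : ℝ))⁻¹ := by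
    intro k
    have h4 := hh.abs_integral_normalizedPow_sub_le hμ hγ (N := 2 ^ k * m) (by positivity)
    rw [hstable _ (by positivity)] at h4
    exact (abs_sub_le _ _ _).trans (add_le_add (h1 k) h4)
  have h5 : Filter.Tendsto (fun k : ℕ => (√((2 ^ k * m : ℕ) : ℝ))⁻¹) Filter.atTop (nhds 0) := by
    refine (Real.tendsto_sqrt_atTop.comp (tendsto_natCast_atTop_atTop.comp ?_)).inv_tendsto_atTop
    exact Filter.tendsto_atTop_mono (fun k => Nat.le_mul_of_pos_right _ hm)
      (tendsto_pow_atTop_atTop_of_one_lt one_lt_two)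
  have h6 := ((h5.const_sub (√(m : ℝ))⁻¹).const_mul C).add (h5.const_mul D)
  simpa using ge_of_tendsto' h6 h3

end

/-! ### The Gaussian limit -/

lemma covariance_eq_integral_mul {Ω : Type*} [MeasurableSpace Ω] {P : Measure Ω}
    {X Y : Ω → ℝ} (hX : ∫ ω, X ω ∂P = 0) (hY : ∫ ω, Y ω ∂P = 0) :
    cov[X, Y; P] = ∫ ω, X ω * Y ω ∂P := by
  simp [covariance, hX, hY]

lemma hasMoments_multivariateGaussian {S : Matrix (Fin n) (Fin n) ℝ} (hS : S.PosSemidef) :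
    HasMoments (multivariateGaussian 0 S) S := by
  have hmean : ∀ i, ∫ y, y i ∂(multivariateGaussian 0 S) = 0 := by
    intro i
    have h1 := (EuclideanSpace.proj (𝕜 := ℝ) i).integral_comp_comm
      (IsGaussian.integrable_fun_id (μ := multivariateGaussian 0 S))
    simpa using h1
  refine ⟨IsGaussian.memLp_id _ 3 (by simp), hmean, fun i j => ?_⟩
  rw [← covariance_eq_integral_mul (hmean i) (hmean j), covariance_eval_multivariateGaussian hS]

/-- The stability of centred Gaussian laws. -/
lemma normalizedPow_multivariateGaussian {S : Matrix (Fin n) (Fin n) ℝ} (hS : S.PosSemidef)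
    {N : ℕ} (hN : 0 < N) :
    normalizedPow (multivariateGaussian 0 S) N = multivariateGaussian 0 S := by
  unfold normalizedPow
  refine Measure.ext_of_charFun ?_
  ext t
  have h1 : (N : ℝ) * ((√(N : ℝ))⁻¹ * (√(N : ℝ))⁻¹) = 1 := by
    rw [← mul_inv, Real.mul_self_sqrt (by positivity), mul_inv_cancel₀ (by positivity)]
  rw [charFun_convPow, charFun_map_smul, charFun_multivariateGaussian hS,
    charFun_multivariateGaussian hS, ← Complex.exp_nat_mul]
  congr 1
  have h2 : (N : ℂ) * (((√(N : ℝ))⁻¹ : ℝ) * ((√(N : ℝ))⁻¹ : ℝ)) = 1 := by exact_mod_cast h1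
  simp only [inner_zero_right, Complex.ofReal_zero, zero_mul, zero_sub, WithLp.ofLp_smul,
    Matrix.mulVec_smul, smul_dotProduct, dotProduct_smul, smul_eq_mul, Complex.ofReal_mul]
  linear_combination (-((t.ofLp ⬝ᵥ S.mulVec t.ofLp : ℝ) : ℂ) / 2) * h2

lemma posSemidef_covMatrix {Ω : Type*} [MeasurableSpace Ω] {P : Measure Ω}
    [IsProbabilityMeasure P] {X : Ω → EuclideanSpace ℝ (Fin n)}
    (hX : ∀ i, MemLp (fun ω => X ω i) 2 P) : (covMatrix P X).PosSemidef := by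
  refine Matrix.PosSemidef.of_dotProduct_mulVec_nonneg ?_ fun x => ?_
  · ext i j
    simp [covMatrix, covariance_comm]
  · have h1 : star x ⬝ᵥ (covMatrix P X).mulVec x = Var[fun ω => ∑ i, x i * X ω i; P] := by
      rw [← covariance_self (Finset.aemeasurable_fun_sum _ fun i _ =>
          (hX i).1.aemeasurable.const_mul _),
        covariance_fun_sum_fun_sum (fun i => (hX i).const_mul _) (fun i => (hX i).const_mul _)]
      simp only [covariance_const_mul_left, covariance_const_mul_right, dotProduct, Matrix.mulVec,
        Finset.mul_sum, covMatrix, Matrix.of_apply]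
      refine Finset.sum_congr rfl fun i _ => Finset.sum_congr rfl fun j _ => ?_
      simp
      ring
    rw [h1]
    exact variance_nonneg _ _

/-! ### The urn model -/

/-- The standardised contribution `(e_k - (1/n, …, 1/n)) / √(1 - 1/n)` of a ball in urn `k`. -/
noncomputable def ballVec (k : Fin n) : EuclideanSpace ℝ (Fin n) :=
  WithLp.toLp 2 fun i => ((if k = i then 1 else 0) - 1 / (n : ℝ)) / √(1 - 1 / (n : ℝ))

/-- The law of the standardised contribution of a uniformly thrown ball. -/
noncomputable def ballLaw (n : ℕ) : Measure (EuclideanSpace ℝ (Fin n)) :=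
  (uniformOn (Set.univ : Set (Fin n))).map ballVec

lemma l1_ballVec_le (k : Fin n) : l1 (ballVec k) ≤ 2 := by
  have hn : (1 : ℝ) ≤ n := by exact_mod_cast k.pos
  have h1 : 1 / (n : ℝ) ≤ 1 := by rw [div_le_one (by positivity)]; exact hn
  -- The norm is `2 √(1 - 1/n)`; for `n = 1` the vector vanishes, as division by zero gives zero.
  have h2 : l1 (ballVec k) = 2 * (1 - 1 / (n : ℝ)) / √(1 - 1 / (n : ℝ)) := by
    unfold l1 ballVec
    rw [← Finset.add_sum_erase _ _ (Finset.mem_univ k)]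
    have h3 : ∀ i ∈ Finset.univ.erase k, |(((if k = i then 1 else 0) - 1 / (n : ℝ)) /
        √(1 - 1 / (n : ℝ)))| = 1 / n / √(1 - 1 / (n : ℝ)) := by
      intro i hi
      rw [if_neg (Finset.ne_of_mem_erase hi).symm, zero_sub, abs_div, abs_neg,
        abs_of_nonneg (Real.sqrt_nonneg _), abs_of_nonneg (by positivity)]
    rw [Finset.sum_congr rfl h3]
    simp only [if_true]
    rw [abs_div, abs_of_nonneg (Real.sqrt_nonneg _),
      abs_of_nonneg (by linarith)]
    simp only [Finset.sum_const, Finset.mem_univ, Finset.card_erase_of_mem, Finset.card_univ,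
      Fintype.card_fin, nsmul_eq_mul, Nat.cast_sub k.pos, Nat.cast_one]
    field_simp
    ring
  rw [h2, mul_div_assoc, Real.div_sqrt]
  have h3 : √(1 - 1 / (n : ℝ)) ≤ 1 := by
    rw [Real.sqrt_le_one]
    have : 0 ≤ 1 / (n : ℝ) := by positivity
    linarith
  linarith

section

variable [NeZero n]

instance isProbabilityMeasure_ballLaw : IsProbabilityMeasure (ballLaw n) := by
  have : IsProbabilityMeasure (uniformOn (Set.univ : Set (Fin n))) :=
    isProbabilityMeasure_uniformOn Set.finite_univ Set.univ_nonempty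
  exact Measure.isProbabilityMeasure_map (measurable_of_finite _).aemeasurable

lemma hasMoments_ballLaw : HasMoments (ballLaw n) fun i j => ∫ y, y i * y j ∂(ballLaw n) where
  memLp := by
    have : IsProbabilityMeasure (uniformOn (Set.univ : Set (Fin n))) :=
      isProbabilityMeasure_uniformOn Set.finite_univ Set.univ_nonempty
    rw [ballLaw, memLp_map_measure_iff (by fun_prop) (measurable_of_finite _).aemeasurable]
    exact MemLp.of_discrete
  mean i := by
    have : IsProbabilityMeasure (uniformOn (Set.univ : Set (Fin n))) :=
      isProbabilityMeasure_uniformOn Set.finite_univ Set.univ_nonempty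
    rw [ballLaw, integral_map (measurable_of_finite _).aemeasurable
      (Measurable.aestronglyMeasurable (by fun_prop)), integral_fintype Integrable.of_finite]
    have h1 : ∀ k : Fin n, (uniformOn (Set.univ : Set (Fin n))).real {k} = (n : ℝ)⁻¹ := by
      intro k
      simp [Measure.real, uniformOn_univ]
    simp only [h1, ballVec, smul_eq_mul, ← Finset.mul_sum, ← Finset.sum_div,
      Finset.sum_sub_distrib]
    simp
  cov i j := rfl

lemma thirdMoment_ballLaw_le : thirdMoment (ballLaw n) ≤ 8 := by
  have h1 : ∀ᵐ y ∂(ballLaw n), l1 y ^ 3 ≤ 8 := by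
    have h2 : Measurable fun y : EuclideanSpace ℝ (Fin n) => l1 y ^ 3 :=
      (continuous_l1.pow 3).measurable
    rw [ballLaw, ae_map_iff (measurable_of_finite _).aemeasurable
      (measurableSet_le h2 measurable_const)]
    refine .of_forall fun k => ?_
    exact (pow_le_pow_left₀ (l1_nonneg _) (l1_ballVec_le k) 3).trans (by norm_num)
  have h2 := integral_mono_ae (integrable_l1_pow (hasMoments_ballLaw (n := n)).memLp)
    (integrable_const (8 : ℝ)) h1
  simpa [thirdMoment] using h2

end

lemma standardCounts_eq_sum {m : ℕ} (u : Fin m → Fin n) :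
    standardCounts u = ∑ j, (√(m : ℝ))⁻¹ • ballVec (u j) := by
  ext i
  simp only [standardCounts, urnCount, ballVec, WithLp.ofLp_sum, WithLp.ofLp_smul,
    Finset.sum_apply, Pi.smul_apply, smul_eq_mul, ← Finset.mul_sum, ← Finset.sum_div,
    Finset.sum_sub_distrib, Finset.sum_boole]
  rw [Real.sqrt_mul (by positivity)]
  simp
  ring

lemma map_standardCounts [NeZero n] {m : ℕ} {Ω : Type*} [MeasurableSpace Ω] {P : Measure Ω}
    [IsProbabilityMeasure P] {U : Fin m → Ω → Fin n} (hU_indep : iIndepFun U P)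
    (hU_unif : ∀ j, HasLaw (U j) (uniformOn Set.univ) P) :
    P.map (fun ω => standardCounts fun j => U j ω) = normalizedPow (ballLaw n) m := by
  have hmeas : ∀ j, AEMeasurable (fun ω => (√(m : ℝ))⁻¹ • ballVec (U j ω)) P := fun j =>
    (measurable_of_finite fun k : Fin n => (√(m : ℝ))⁻¹ • ballVec k).comp_aemeasurable
      (hU_unif j).aemeasurable
  have hlaw : ∀ j, P.map (fun ω => (√(m : ℝ))⁻¹ • ballVec (U j ω)) =
      (ballLaw n).map ((√(m : ℝ))⁻¹ • ·) := by
    intro j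
    rw [ballLaw, Measure.map_map (by fun_prop) (measurable_of_finite _), ← (hU_unif j).map_eq,
      AEMeasurable.map_map_of_aemeasurable (measurable_of_finite _).aemeasurable
        (hU_unif j).aemeasurable]
    rfl
  simp only [standardCounts_eq_sum]
  have : IsProbabilityMeasure (P.map fun ω => ∑ j, (√(m : ℝ))⁻¹ • ballVec (U j ω)) :=
    Measure.isProbabilityMeasure_map (Finset.aemeasurable_fun_sum _ fun j _ => hmeas j)
  unfold normalizedPow
  refine Measure.ext_of_charFun ?_
  have hind : iIndepFun (fun j ω => (√(m : ℝ))⁻¹ • ballVec (U j ω)) P :=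
    hU_indep.comp (fun _ k => (√(m : ℝ))⁻¹ • ballVec k) fun _ => measurable_of_finite _
  rw [hind.charFun_map_fun_sum_eq_prod hmeas]
  ext t
  rw [charFun_convPow]
  simp [hlaw]

/-- The covariance matrix of the standardised counts is that of a single ball. -/
lemma covMatrix_standardCounts [NeZero n] {m : ℕ} (hm : 0 < m) {Ω : Type*} [MeasurableSpace Ω]
    {P : Measure Ω} {X : Ω → EuclideanSpace ℝ (Fin n)}
    (hX : HasLaw X (normalizedPow (ballLaw n) m) P) :
    covMatrix P X = fun i j => ∫ y, y i * y j ∂(ballLaw n) := by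
  have h1 := (hasMoments_ballLaw (n := n)).normalizedPow hm
  ext i j
  rw [← h1.cov i j, ← covariance_eq_integral_mul (h1.mean i) (h1.mean j)]
  exact hX.covariance_comp (f := fun y => y i) (g := fun y => y j)
    (Measurable.aemeasurable (by fun_prop)) (Measurable.aemeasurable (by fun_prop))

lemma inv_sqrt_le_rate {m n : ℕ} (hm : 1 ≤ m) (hn : 2 ≤ n) :
    (√(m : ℝ))⁻¹ ≤ √(((n : ℝ) ^ 2 + 4 * (m : ℝ) * (n : ℝ) + 6) /
      ((m : ℝ) * (n : ℝ) * ((n : ℝ) - 1))) := by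
  have hm' : (1 : ℝ) ≤ m := by exact_mod_cast hm
  have hn' : (2 : ℝ) ≤ n := by exact_mod_cast hn
  have hn1 : (0 : ℝ) < n - 1 := by linarith
  rw [← Real.sqrt_inv]
  refine Real.sqrt_le_sqrt ?_
  rw [inv_eq_one_div, div_le_div_iff₀ (by positivity) (by positivity)]
  have : 0 ≤ (m : ℝ) * ((n : ℝ) + 4 * m * n + 6) := by positivity
  linarith

end Occupancy

theorem mainTheorem7 {m n : ℕ} (hm : 1 ≤ m) (hn : 2 ≤ n)
    {Ω : Type*} [MeasurableSpace Ω] (P : Measure Ω) [IsProbabilityMeasure P]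
    (U : Fin m → Ω → Fin n) (hU_indep : iIndepFun U P)
    (hU_unif : ∀ j, HasLaw (U j) (uniformOn Set.univ) P)
    (X : Ω → EuclideanSpace ℝ (Fin n))
    (hX : X = fun ω => Occupancy.standardCounts fun j => U j ω)
    {Ω' : Type*} [MeasurableSpace Ω'] (P' : Measure Ω') [IsProbabilityMeasure P']
    (Z : Ω' → EuclideanSpace ℝ (Fin n))
    (hZ : HasLaw Z (multivariateGaussian 0 (Occupancy.covMatrix P X)) P')
    (h : EuclideanSpace ℝ (Fin n) → ℝ) (hh : Occupancy.PartiallyDifferentiable 3 h) :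
    Integrable (fun ω => h (X ω)) P ∧
    (Occupancy.derivNorm 2 h ≠ ∞ → Occupancy.derivNorm 3 h ≠ ∞ →
      Integrable (fun ω => h (Z ω)) P') ∧
    ENNReal.ofReal |∫ ω, h (X ω) ∂P - ∫ ω, h (Z ω) ∂P'| ≤
      (Occupancy.derivNorm 2 h + 19 * Occupancy.derivNorm 3 h) *
        ENNReal.ofReal √(((n : ℝ) ^ 2 + 4 * (m : ℝ) * (n : ℝ) + 6) /
          ((m : ℝ) * (n : ℝ) * ((n : ℝ) - 1))) := by
  have : NeZero n := ⟨by omega⟩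
  have hU : AEMeasurable (fun ω j => U j ω) P :=
    aemeasurable_pi_lambda _ fun j => (hU_unif j).aemeasurable
  have hXmeas : AEMeasurable X P := by
    rw [hX]
    exact (measurable_of_finite Occupancy.standardCounts).comp_aemeasurable hU
  have hXlaw : HasLaw X (Occupancy.normalizedPow (Occupancy.ballLaw n) m) P :=
    ⟨hXmeas, by rw [hX]; exact Occupancy.map_standardCounts hU_indep hU_unif⟩
  have hrate := Occupancy.inv_sqrt_le_rate hm hn
  have hr0 : 0 < (√(m : ℝ))⁻¹ := by positivity
  refine ⟨?_, fun _ h3 => ?_, ?_⟩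
  · have : IsProbabilityMeasure (P.map fun ω j => U j ω) := Measure.isProbabilityMeasure_map hU
    have h1 : Integrable (fun u : Fin m → Fin n => h (Occupancy.standardCounts u))
        (P.map fun ω j => U j ω) := Integrable.of_finite
    rw [hX]
    exact h1.comp_aemeasurable hU
  · have hc := Occupancy.hasCubicRemainder_of_derivNorm_ne_top hh h3
    have h1 := hc.integrable (IsGaussian.memLp_id
      (multivariateGaussian 0 (Occupancy.covMatrix P X)) 3 (by simp))
    rw [← hZ.map_eq] at h1
    exact h1.comp_aemeasurable hZ.aemeasurable
  · -- If `|h|₃ = ∞`, the right-hand side is `∞`, as the square root is positive.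
    by_cases h3 : Occupancy.derivNorm 3 h = ∞
    · rw [h3, ENNReal.mul_top (by norm_num), add_top,
        ENNReal.top_mul (ENNReal.ofReal_pos.2 (hr0.trans_le hrate)).ne']
      exact le_top
    have hc := Occupancy.hasCubicRemainder_of_derivNorm_ne_top hh h3
    set M := (Occupancy.derivNorm 3 h).toReal with hM
    have hM0 : 0 ≤ M := ENNReal.toReal_nonneg
    have hmom := (Occupancy.hasMoments_ballLaw (n := n)).normalizedPow hm
    have hpsd : (Occupancy.covMatrix P X).PosSemidef := by
      refine Occupancy.posSemidef_covMatrix fun i => ?_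
      have h1 := hmom.memLp
      rw [← hXlaw.map_eq, memLp_map_measure_iff (by fun_prop) hXmeas] at h1
      exact (MemLp.of_le_mul (c := 1) h1
        ((Measurable.aestronglyMeasurable (f := fun y : EuclideanSpace ℝ (Fin n) => y i)
          (by fun_prop)).comp_aemeasurable hXmeas)
        (.of_forall fun ω => by simpa using PiLp.norm_apply_le (X ω) i)).mono_exponent
          (by norm_num)
    have hgauss := Occupancy.hasMoments_multivariateGaussian hpsd
    have hball := Occupancy.hasMoments_ballLaw (n := n)
    rw [← Occupancy.covMatrix_standardCounts hm hXlaw] at hball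
    -- The third moment of a single ball is at most `8`, and `19 / 8 * 8 = 19`.
    have key := hc.abs_integral_normalizedPow_sub_stable_le hM0 hball hgauss
      (fun N hN => Occupancy.normalizedPow_multivariateGaussian hpsd hN) hm
    have hc' := hc.continuous
    have e1 : ∫ ω, h (X ω) ∂P = _ := hXlaw.integral_comp hc'.aestronglyMeasurable
    have e2 : ∫ ω, h (Z ω) ∂P' = _ := hZ.integral_comp hc'.aestronglyMeasurable
    rw [e1, e2]
    set R := √(((n : ℝ) ^ 2 + 4 * (m : ℝ) * (n : ℝ) + 6) /
          ((m : ℝ) * (n : ℝ) * ((n : ℝ) - 1)))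
    calc ENNReal.ofReal |_|
        ≤ ENNReal.ofReal (19 * M * R) := by
          refine ENNReal.ofReal_le_ofReal (key.trans ?_)
          calc 19 / 8 * M * Occupancy.thirdMoment (Occupancy.ballLaw n) * (√(m : ℝ))⁻¹
              ≤ 19 / 8 * M * 8 * R := by
                gcongr
                exact Occupancy.thirdMoment_ballLaw_le
            _ = 19 * M * R := by ring
      _ = 19 * Occupancy.derivNorm 3 h * ENNReal.ofReal R := by
          rw [ENNReal.ofReal_mul (by positivity), ENNReal.ofReal_mul (by norm_num), hM,
            ENNReal.ofReal_toReal h3]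
          norm_num
      _ ≤ _ := by
          gcongr
          exact le_add_self
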